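/- Let $\mathcal H$ be a complex Hilbert space (of any dimension) and let $\Theta$, $U$ be compact metric spaces with $U\neq\emptyset$. A quantum statistical model is a map $\theta\mapsto\rho(\theta)$ from $\Theta$ to the trace-class operators on $\mathcal H$ with $\rho(\theta)\ge 0$ and $\operatorname{Tr}\rho(\theta)=1$. For a compact set $K\subseteq\Theta$ and $\delta>0$ let $$\omega_\rho(K_\delta)=\inf\{\|X\|_1 : X \text{ trace class},\ -X\le\rho(\theta)-\rho(\eta)\le X \text{ for all } \theta,\eta\in K \text{ with } d(\theta,\eta)<\delta\}$$ (with $\inf\emptyset=\infty$); the model is regular if $\lim_{\delta\to0}\omega_\rho(K_\delta)=0$ for every compact $K\subseteq\Theta$. A POVM on $U$ is a map $M$ from the Borel sets of $U$ to the bounded operators on $\mathcal H$ such that $M(B)\ge0$ for every Borel set $B$, $M(U)=I$, and $M(\bigcup_j B_j)=\sum_j M(B_j)$ in the weak operator topology for every sequence $(B_j)$ of pairwise disjoint Borel sets. Given a function $w:\Theta\times U\to\mathbb R$, the risk function of a POVM $M$ is $$R_M(\theta)=\int_U w(\theta,u)\,\operatorname{Tr}\bigl(\rho(\theta)M(du)\bigr),\qquad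 \theta\in\Theta.$$ **Theorem.** Let $\rho$ be a regular quantum statistical model and let the loss function $w:\Theta\times U\to\mathbb R$ be continuous. Then for every continuous function $f:\Theta\to\mathbb R$ the following are equivalent: 1. there exists a POVM $M$ on $U$ such that $f(\theta)\ge R_M(\theta)$ for every $\theta\in\Theta$; 2. for every Borel probability measure $\pi$ on $\Theta$, $$\int_\Theta f\,d\pi\ \ge\ \inf_{M}\int_\Theta R_M\,d\pi,$$ where the infimum is over all POVMs $M$ on $U$. -/

import Mathlib

open MeasureTheory Filter Topology
open scoped ENNReal NNReal ComplexOrder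

set_option linter.unusedSectionVars false

noncomputable section

namespace QuantumDecision

section TraceClass

variable (H : Type*) [NormedAddCommGroup H] [InnerProductSpace ℂ H] [CompleteSpace H]

/-- The index set of a fixed orthonormal (Hilbert) basis of `H`. -/
def basisIndex : Set H := (exists_hilbertBasis ℂ H).choose

/-- A fixed orthonormal (Hilbert) basis of `H`. The trace norm of any operator and the trace of any
trace-class operator do not depend on this choice. -/
def basis : HilbertBasis (basisIndex H) ℂ H := (exists_hilbertBasis ℂ H).choose_spec.choose

variable {H}

/-- The trace norm `‖T‖₁ = Tr |T|` with `|T| = (T* T)^{1/2}`, equal to `∞` if `T` is not trace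
class. -/
def traceNorm (T : H →L[ℂ] H) : ℝ≥0∞ :=
  ∑' i, ENNReal.ofReal (inner ℂ (basis H i) (CFC.abs T (basis H i))).re

/-- Trace-class operators. -/
def IsTraceClass (T : H →L[ℂ] H) : Prop := traceNorm T < ∞

/-- The trace of an operator (meaningful for trace-class operators). -/
def trace (T : H →L[ℂ] H) : ℂ := ∑' i, inner ℂ (basis H i) (T (basis H i))

lemma sqrt_inner (T : H →L[ℂ] H) (x y : H) :
    inner ℂ (CFC.sqrt T x) y = inner ℂ x (CFC.sqrt T y) :=
  ((ContinuousLinearMap.nonneg_iff_isPositive _).1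
    (CFC.sqrt_nonneg T)).inner_left_eq_inner_right x y

lemma inner_sqrt_sqrt {T : H →L[ℂ] H} (hT : 0 ≤ T) (x y : H) :
    inner ℂ (CFC.sqrt T x) (CFC.sqrt T y) = inner ℂ x (T y) := by
  rw [sqrt_inner, ← mul_apply_eq_comp, CFC.sqrt_mul_sqrt_self T hT]

lemma summable_sqrt_sq {T : H →L[ℂ] H} (hT : 0 ≤ T) (hT1 : IsTraceClass T) :
    Summable fun i => ‖CFC.sqrt T (basis H i)‖ ^ 2 := by
  have h1 : (∑' i, ENNReal.ofReal (‖CFC.sqrt T (basis H i)‖ ^ 2)) ≠ ∞ := by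
    have h2 : traceNorm T ≠ ∞ := ne_of_lt hT1
    rw [traceNorm, CFC.abs_of_nonneg T hT] at h2
    convert h2 using 4 with i
    rw [← inner_sqrt_sqrt hT]
    exact (inner_self_eq_norm_sq (𝕜 := ℂ) _).symm
  have h3 := ENNReal.summable_toReal h1
  simpa [ENNReal.toReal_ofReal] using h3

lemma hasSum_norm_inner_sq {ι : Type*} (b : HilbertBasis ι ℂ H) (x : H) :
    HasSum (fun i => ‖inner ℂ x (b i)‖ ^ 2) (‖x‖ ^ 2) := by
  have h := b.hasSum_inner_mul_inner x x
  have h2 := Complex.hasSum_re h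
  have h3 : (inner ℂ x x : ℂ).re = ‖x‖ ^ 2 := inner_self_eq_norm_sq (𝕜 := ℂ) x
  rw [h3] at h2
  convert h2 using 2 with i
  rw [← inner_conj_symm (b i) x, Complex.mul_conj, Complex.normSq_eq_norm_sq]
  norm_cast

lemma summable_prod_inner_sq {ι : Type*} (b : HilbertBasis ι ℂ H) (B S : H →L[ℂ] H)
    (hS2 : Summable fun i => ‖S (b i)‖ ^ 2) :
    Summable fun p : ι × ι =>
      ‖inner ℂ (B (S (b p.1))) (b p.2)‖ ^ 2 := by
  rw [summable_prod_of_nonneg (fun p => by positivity)]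
  refine ⟨fun i => (hasSum_norm_inner_sq b (B (S (b i)))).summable, ?_⟩
  refine Summable.of_nonneg_of_le (fun i => tsum_nonneg fun j => by positivity) (fun i => ?_)
    (hS2.mul_left (‖B‖ ^ 2))
  refine ((hasSum_norm_inner_sq b (B (S (b i)))).tsum_eq).le.trans ?_
  rw [← mul_pow]
  exact pow_le_pow_left₀ (norm_nonneg _) (B.le_opNorm _) 2

lemma exists_hasSum_trace {ι : Type*} (b : HilbertBasis ι ℂ H) (A S : H →L[ℂ] H)
    (hS : ∀ x y, inner ℂ (S x) y = inner ℂ x (S y))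
    (hS2 : Summable fun i => ‖S (b i)‖ ^ 2) :
    ∃ t : ℂ, HasSum (fun i => inner ℂ (S (b i)) (S (A (b i)))) t ∧
      HasSum (fun i => inner ℂ (S (b i)) (A (S (b i)))) t := by
  have hsw : ∀ i j, inner ℂ (b j) (S (A (b i)))
      = inner ℂ (ContinuousLinearMap.adjoint A (S (b j))) (b i) := by
    intro i j
    rw [ContinuousLinearMap.adjoint_inner_left, hS]
  have hx := summable_prod_inner_sq b 1 S hS2
  have hy0 := summable_prod_inner_sq b (ContinuousLinearMap.adjoint A) S hS2
  have hy : Summable fun p : ι × ι =>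
      ‖inner ℂ (b p.2) (S (A (b p.1)))‖ ^ 2 := by
    refine ((Equiv.prodComm _ _).summable_iff.2 hy0).congr fun p => ?_
    simp [hsw]
  have hF : Summable fun p : ι × ι =>
      inner ℂ (S (b p.1)) (b p.2) *
        inner ℂ (b p.2) (S (A (b p.1))) := by
    refine Summable.of_norm_bounded (hx.add hy) fun p => ?_
    rw [norm_mul, one_apply_eq_self]
    nlinarith [sq_nonneg (‖inner ℂ (S (b p.1)) (b p.2)‖
      - ‖inner ℂ (b p.2) (S (A (b p.1)))‖),
      sq_nonneg ‖inner ℂ (S (b p.1)) (b p.2)‖,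
      sq_nonneg ‖inner ℂ (b p.2) (S (A (b p.1)))‖]
  refine ⟨_, hF.hasSum.prod_fiberwise fun i =>
    b.hasSum_inner_mul_inner (S (b i)) (S (A (b i))), ?_⟩
  refine ((Equiv.prodComm _ _).hasSum_iff.2 hF.hasSum).prod_fiberwise fun j => ?_
  have h := b.hasSum_inner_mul_inner
    (ContinuousLinearMap.adjoint A (S (b j))) (S (b j))
  rw [ContinuousLinearMap.adjoint_inner_left] at h
  have e : (fun i => inner ℂ (ContinuousLinearMap.adjoint A (S (b j))) (b i) *
      inner ℂ (b i) (S (b j))) =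
      fun i => inner ℂ (S (b i)) (b j) * inner ℂ (b j) (S (A (b i))) := by
    funext i
    rw [hsw, hS, mul_comm]
  rw [e] at h
  exact h

/-- For a positive trace-class `T` and a bounded `A`, the series defining `Tr (T A)` converges and
`Tr (T A) = Tr (T^{1/2} A T^{1/2})`. -/
lemma hasSum_trace_mul {T : H →L[ℂ] H} (hT : 0 ≤ T) (hT1 : IsTraceClass T) (A : H →L[ℂ] H) :
    HasSum (fun i => inner ℂ (basis H i) ((T * A) (basis H i))) (trace (T * A)) ∧
      HasSum (fun i => inner ℂ (CFC.sqrt T (basis H i)) (A (CFC.sqrt T (basis H i))))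
        (trace (T * A)) := by
  obtain ⟨t, h1, h2⟩ := exists_hasSum_trace (basis H) A (CFC.sqrt T) (sqrt_inner T)
    (summable_sqrt_sq hT hT1)
  have h1' : HasSum (fun i => inner ℂ (basis H i) ((T * A) (basis H i))) t := by
    convert h1 using 2 with i
    rw [inner_sqrt_sqrt hT, mul_apply_eq_comp]
  have h3 : trace (T * A) = t := h1'.tsum_eq
  rw [h3]
  exact ⟨h1', h2⟩

end TraceClass

section Measurements

variable (U H : Type*) [MeasurableSpace U]
  [NormedAddCommGroup H] [InnerProductSpace ℂ H] [CompleteSpace H]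

/-- A measurement (positive-operator-valued measure) on `U`; only the values on measurable sets
matter. Countable additivity is convergence in the weak operator topology. -/
structure POVM where
  toFun : Set U → H →L[ℂ] H
  nonneg : ∀ B, MeasurableSet B → 0 ≤ toFun B
  hasSum_iUnion : ∀ B : ℕ → Set U, (∀ j, MeasurableSet (B j)) →
    Pairwise (Function.onFun Disjoint B) → ∀ x y : H,
      HasSum (fun j => inner ℂ x (toFun (B j) y)) (inner ℂ x (toFun (⋃ j, B j) y))
  univ : toFun Set.univ = 1

variable {U H}

/-- Born's rule as a sum over the basis, with nonnegative terms. -/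
lemma ofReal_trace_mul {T : H →L[ℂ] H} (hT : 0 ≤ T) (hT1 : IsTraceClass T)
    {A : H →L[ℂ] H} (hA : 0 ≤ A) :
    ENNReal.ofReal (trace (T * A)).re = ∑' i, ENNReal.ofReal
      (inner ℂ (CFC.sqrt T (basis H i)) (A (CFC.sqrt T (basis H i)))).re := by
  have h := Complex.hasSum_re (hasSum_trace_mul hT hT1 A).2
  rw [← h.tsum_eq, ENNReal.ofReal_tsum_of_nonneg (fun i => ?_) h.summable]
  exact ((ContinuousLinearMap.nonneg_iff_isPositive A).1 hA).re_inner_nonneg_right _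

lemma POVM.apply_empty (M : POVM U H) : M.toFun ∅ = 0 := by
  ext y
  refine ext_inner_left ℂ fun x => ?_
  have h := M.hasSum_iUnion (fun _ => ∅) (fun _ => MeasurableSet.empty)
    (fun i j _ => by simp [Function.onFun]) x y
  have h2 := h.summable.tendsto_atTop_zero
  simpa using tendsto_nhds_unique tendsto_const_nhds h2

/-- The distribution of the outcome of the measurement `M` in the state `T` (a positive trace-class
operator), given by Born's rule `B ↦ Tr (T M(B))`. -/
def outcomeMeasure (T : H →L[ℂ] H) (hT : 0 ≤ T) (hT1 : IsTraceClass T) (M : POVM U H) :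
    Measure U :=
  Measure.ofMeasurable (fun B _ => ENNReal.ofReal (trace (T * M.toFun B)).re)
    (by simp [M.apply_empty, trace])
    (by
      intro B hB hd
      rw [ofReal_trace_mul hT hT1 (M.nonneg _ (MeasurableSet.iUnion hB))]
      simp_rw [fun j => ofReal_trace_mul hT hT1 (M.nonneg _ (hB j))]
      rw [ENNReal.tsum_comm]
      congr 1
      ext i
      have h := Complex.hasSum_re (M.hasSum_iUnion B hB hd (CFC.sqrt T (basis H i))
        (CFC.sqrt T (basis H i)))
      rw [← h.tsum_eq, ENNReal.ofReal_tsum_of_nonneg (fun j => ?_) h.summable]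
      exact ((ContinuousLinearMap.nonneg_iff_isPositive _).1
        (M.nonneg _ (hB j))).re_inner_nonneg_right _)

end Measurements

section Models

variable (Θ H : Type*) [NormedAddCommGroup H] [InnerProductSpace ℂ H] [CompleteSpace H]

/-- A quantum statistical model: a family of density operators on `H` indexed by `Θ`. -/
structure Model where
  toFun : Θ → H →L[ℂ] H
  nonneg : ∀ θ, 0 ≤ toFun θ
  traceClass : ∀ θ, IsTraceClass (toFun θ)
  trace_eq_one : ∀ θ, trace (toFun θ) = 1

variable {Θ H}

/-- `ω_T(K_δ)`: the infimum of the trace norms of the trace-class operators `X` such that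
`-X ≤ T θ - T η ≤ X` for all `θ, η ∈ K` with `d(θ, η) < δ`; it is `∞` if there is none. -/
def modulus [PseudoMetricSpace Θ] (T : Θ → H →L[ℂ] H) (K : Set Θ) (δ : ℝ) : ℝ≥0∞ :=
  ⨅ X ∈ {X : H →L[ℂ] H | IsTraceClass X ∧ ∀ θ ∈ K, ∀ η ∈ K, dist θ η < δ →
    -X ≤ T θ - T η ∧ T θ - T η ≤ X}, traceNorm X

/-- Regularity of an operator-valued function. -/
def IsRegular [PseudoMetricSpace Θ] (T : Θ → H →L[ℂ] H) : Prop :=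
  ∀ K : Set Θ, IsCompact K → Tendsto (fun δ : ℝ => modulus T K δ) (𝓝[>] 0) (𝓝 0)

/-- The risk function `R_M(θ) = ∫ w(θ, u) Tr (ρ(θ) M(du))`. -/
def risk {U : Type*} [MeasurableSpace U] (ρ : Model Θ H) (w : Θ × U → ℝ) (M : POVM U H)
    (θ : Θ) : ℝ :=
  ∫ u, w (θ, u) ∂(outcomeMeasure (ρ.toFun θ) (ρ.nonneg θ) (ρ.traceClass θ) M)

end Models

end QuantumDecision

end

/-! The implication from 1 to 2 is integration of `R_M ≤ f` against `π`. Regularity is what makes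
`R_M` integrable: if `-X ≤ ρ(θ) - ρ(η) ≤ X` and `0 ≤ A ≤ 1`, then `Tr ρ(θ)A` and `Tr ρ(η)A` differ
by at most `‖X‖₁`, so outcome probabilities are continuous in `θ`, and the bounded function `R_M` is
measurable.

The converse is a minimax argument followed by compactness. Measurements are replaced by positive
unital maps `Ψ : C(U, ℝ) → B(H)`; the two notions correspond by an operator-valued Riesz theorem
(`POVM.exists_represents`, `IsPositiveUnital.exists_povm`), and the risk becomes `Re Tr (ρ(θ) Ψ(w(θ,
·)))`, which is affine in `Ψ`. For finitely many parameters and `ε > 0`, separating the convex set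
of vectors `R_Ψ - f` from the box of vectors with all entries below `ε` would produce a finitely
supported prior violating 2; hence some `Ψ` satisfies `R_Ψ < f + ε` at these parameters
(`exists_isPositiveUnital_forall_mem_lt`). Positive unital maps are contractive, so they have
point-weak limits along ultrafilters, and the risk at each fixed `θ` passes to the limit by
dominated convergence (`tendsto_re_trace_mul`). The limit over growing finite sets and shrinking `ε`
is the required measurement. -/

noncomputable section

namespace QuantumDecision

/-! ### Operators determined by their quadratic forms; weak limits. -/

section QuadraticForms

variable {H : Type*} [NormedAddCommGroup H] [InnerProductSpace ℂ H]

lemma isSymmetric_of_inner_eq_ofReal {A : H →L[ℂ] H} {q : H → ℝ}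
    (hA : ∀ x, inner ℂ x (A x) = (q x : ℂ)) : (A : H →ₗ[ℂ] H).IsSymmetric := by
  rw [LinearMap.isSymmetric_iff_inner_map_self_real]
  intro x
  have h : inner ℂ (A x) x = (q x : ℂ) := by
    rw [← inner_conj_symm, hA, Complex.conj_ofReal]
  simp [h]

lemma eq_of_inner_self_eq {A B : H →L[ℂ] H} (h : ∀ x, inner ℂ x (A x) = inner ℂ x (B x)) :
    A = B := by
  have h2 : (A : H →ₗ[ℂ] H) = B := by
    rw [← ext_inner_map]
    intro x
    have := congrArg (starRingEnd ℂ) (h x)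
    simpa using this
  exact ContinuousLinearMap.coe_injective h2

/-- Polarization: `⟪x, A y⟫` is a combination of four values of the quadratic form of `A`. -/
lemma inner_polarization (A : H →L[ℂ] H) (x y : H) :
    inner ℂ x (A y) = (inner ℂ (x + y) (A (x + y)) - inner ℂ (x - y) (A (x - y)) -
      Complex.I * inner ℂ (x + Complex.I • y) (A (x + Complex.I • y)) +
      Complex.I * inner ℂ (x - Complex.I • y) (A (x - Complex.I • y))) / 4 := by
  simp only [map_add, map_sub, inner_add_left, inner_add_right, map_smul, inner_smul_left,
    inner_smul_right, Complex.conj_I, ← pow_two, Complex.I_sq, inner_sub_left, inner_sub_right,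
    mul_add, ← mul_assoc, mul_neg, neg_neg, one_mul, neg_one_mul, mul_sub, sub_sub]
  ring

variable [CompleteSpace H]

lemma nonneg_of_inner_eq_ofReal {A : H →L[ℂ] H} {q : H → ℝ}
    (hA : ∀ x, inner ℂ x (A x) = (q x : ℂ)) (hq : ∀ x, 0 ≤ q x) : 0 ≤ A := by
  rw [ContinuousLinearMap.nonneg_iff_isPositive]
  refine ⟨isSymmetric_of_inner_eq_ofReal hA, fun x => ?_⟩
  rw [ContinuousLinearMap.reApplyInnerSelf_apply, inner_re_symm, hA]
  simpa using hq x

lemma inner_self_eq_re {A : H →L[ℂ] H} (hA : IsSelfAdjoint A) (x : H) :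
    inner ℂ x (A x) = ((inner ℂ x (A x)).re : ℂ) :=
  (hA.isSymmetric.coe_re_inner_self_apply x).symm

lemma re_inner_self_nonneg {A : H →L[ℂ] H} (hA : 0 ≤ A) (x : H) : 0 ≤ (inner ℂ x (A x)).re :=
  ((ContinuousLinearMap.nonneg_iff_isPositive A).1 hA).re_inner_nonneg_right x

lemma norm_le_of_abs_inner_le {A : H →L[ℂ] H} {q : H → ℝ} {C : ℝ} (hC : 0 ≤ C)
    (hA : ∀ x, inner ℂ x (A x) = (q x : ℂ)) (hq : ∀ x, |q x| ≤ C * ‖x‖ ^ 2) : ‖A‖ ≤ C := by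
  rw [A.norm_eq_iSup_rayleighQuotient (isSymmetric_of_inner_eq_ofReal hA)]
  refine ciSup_le fun x => ?_
  rw [ContinuousLinearMap.rayleighQuotient, ContinuousLinearMap.reApplyInnerSelf_apply,
    inner_re_symm, hA]
  rcases eq_or_ne x 0 with rfl | hx
  · simpa using hC
  · have : 0 < ‖x‖ ^ 2 := by positivity
    rw [abs_div, abs_of_pos this, div_le_iff₀ this]
    simpa using hq x

/-- Bounded families of operators converge in the weak operator topology along ultrafilters. -/
lemma exists_tendsto_inner {ι : Type*} (F : Ultrafilter ι) (A : ι → H →L[ℂ] H) {C : ℝ}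
    (hC : ∀ i, ‖A i‖ ≤ C) :
    ∃ T : H →L[ℂ] H, ∀ x y, Tendsto (fun i => inner ℂ x (A i y)) F (𝓝 (inner ℂ x (T y))) := by
  have hb : ∀ x y i, ‖inner ℂ (A i x) y‖ ≤ C * ‖x‖ * ‖y‖ := fun x y i => by
    refine (norm_inner_le_norm _ _).trans ?_
    gcongr
    exact (A i).le_of_opNorm_le (hC i) x
  have hlim : ∀ x y, ∃ z, ‖z‖ ≤ C * ‖x‖ * ‖y‖ ∧
      Tendsto (fun i => inner ℂ (A i x) y) F (𝓝 z) := by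
    intro x y
    obtain ⟨z, hz, hz2⟩ := (isCompact_closedBall (0 : ℂ) (C * ‖x‖ * ‖y‖)).ultrafilter_le_nhds
      (F.map fun i => inner ℂ (A i x) y) (by
        rw [Ultrafilter.coe_map, le_principal_iff]
        exact Filter.mem_map.2 (Filter.univ_mem' fun i => by simpa using hb x y i))
    exact ⟨z, by simpa using hz, hz2⟩
  choose L hL1 hL2 using hlim
  -- The pointwise limits form a bounded sesquilinear form, by uniqueness of limits; the operator
  -- representing it is `T`.
  let B : H →L⋆[ℂ] H →L[ℂ] ℂ := LinearMap.mkContinuous₂ (LinearMap.mk₂'ₛₗ (starRingEnd ℂ)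
    (RingHom.id ℂ) L
    (fun x x' y => tendsto_nhds_unique (hL2 (x + x') y)
      (((hL2 x y).add (hL2 x' y)).congr fun i => by simp))
    (fun c x y => tendsto_nhds_unique (hL2 (c • x) y)
      (((hL2 x y).const_mul (starRingEnd ℂ c)).congr fun i => by simp [mul_comm]))
    (fun x y y' => tendsto_nhds_unique (hL2 x (y + y'))
      (((hL2 x y).add (hL2 x y')).congr fun i => by simp))
    (fun c x y => tendsto_nhds_unique (hL2 x (c • y))
      (((hL2 x y).const_mul c).congr fun i => by simp)))
    C (fun x y => hL1 x y)
  refine ⟨InnerProductSpace.continuousLinearMapOfBilin B, fun x y => ?_⟩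
  have h := ((Complex.continuous_conj.tendsto _).comp (hL2 y x))
  have e : B y x = L y x := rfl
  rw [← inner_conj_symm, InnerProductSpace.continuousLinearMapOfBilin_apply, e]
  exact h.congr fun i => by simp

/-- A pointwise limit of uniformly bounded quadratic forms of bounded operators is the quadratic
form of a bounded operator. -/
lemma exists_inner_eq_of_tendsto {ι : Type*} {F : Filter ι} [F.NeBot] {A : ι → H →L[ℂ] H}
    {r : ι → H → ℝ} {q : H → ℝ} {C : ℝ} (hC : 0 ≤ C)
    (hA : ∀ i x, inner ℂ x (A i x) = (r i x : ℂ)) (hr : ∀ i x, |r i x| ≤ C * ‖x‖ ^ 2)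
    (hq : ∀ x, Tendsto (fun i => r i x) F (𝓝 (q x))) :
    ∃ T : H →L[ℂ] H, ∀ x, inner ℂ x (T x) = (q x : ℂ) := by
  obtain ⟨T, hT⟩ := exists_tendsto_inner (Ultrafilter.of F) A
    (fun i => norm_le_of_abs_inner_le hC (hA i) (hr i))
  refine ⟨T, fun x => tendsto_nhds_unique (hT x x) ?_⟩
  simp_rw [hA]
  exact (Complex.continuous_ofReal.tendsto _).comp ((hq x).mono_left (Ultrafilter.of_le F))

end QuadraticForms

/-! ### Positivity, comparison and continuity of `Tr (T A)`. -/

section Trace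

variable {H : Type*} [NormedAddCommGroup H] [InnerProductSpace ℂ H] [CompleteSpace H]

lemma hasSum_re_trace_mul {T : H →L[ℂ] H} (hT : 0 ≤ T) (hT1 : IsTraceClass T) (A : H →L[ℂ] H) :
    HasSum (fun i => (inner ℂ (CFC.sqrt T (basis H i)) (A (CFC.sqrt T (basis H i)))).re)
      (trace (T * A)).re :=
  Complex.hasSum_re (hasSum_trace_mul hT hT1 A).2

lemma re_trace_mul_nonneg {T : H →L[ℂ] H} (hT : 0 ≤ T) (hT1 : IsTraceClass T) {A : H →L[ℂ] H}
    (hA : 0 ≤ A) : 0 ≤ (trace (T * A)).re :=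
  (hasSum_re_trace_mul hT hT1 A).nonneg fun _ => re_inner_self_nonneg hA _

lemma re_trace_mul_add {T : H →L[ℂ] H} (hT : 0 ≤ T) (hT1 : IsTraceClass T) (A B : H →L[ℂ] H) :
    (trace (T * (A + B))).re = (trace (T * A)).re + (trace (T * B)).re := by
  refine (hasSum_re_trace_mul hT hT1 (A + B)).unique ?_
  simpa [inner_add_right] using
    (hasSum_re_trace_mul hT hT1 A).add (hasSum_re_trace_mul hT hT1 B)

lemma re_trace_mul_smul {T : H →L[ℂ] H} (hT : 0 ≤ T) (hT1 : IsTraceClass T) (c : ℝ)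
    (A : H →L[ℂ] H) : (trace (T * (c • A))).re = c * (trace (T * A)).re := by
  refine (hasSum_re_trace_mul hT hT1 (c • A)).unique ?_
  simpa [inner_smul_right_eq_smul] using (hasSum_re_trace_mul hT hT1 A).mul_left c

lemma traceNorm_of_nonneg {T : H →L[ℂ] H} (hT : 0 ≤ T) :
    traceNorm T = ∑' i, ENNReal.ofReal (inner ℂ (basis H i) (T (basis H i))).re := by
  rw [traceNorm, CFC.abs_of_nonneg T hT]

lemma isTraceClass_of_le_add {S T X : H →L[ℂ] H} (hS : 0 ≤ S) (hT : 0 ≤ T) (hT1 : IsTraceClass T)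
    (hX : 0 ≤ X) (hX1 : IsTraceClass X) (h : S ≤ T + X) : IsTraceClass S := by
  rw [IsTraceClass, traceNorm_of_nonneg] at *
  any_goals assumption
  refine lt_of_le_of_lt ?_ (ENNReal.add_lt_top.2 ⟨hT1, hX1⟩)
  rw [← ENNReal.tsum_add]
  refine ENNReal.tsum_le_tsum fun i => ?_
  rw [← ENNReal.ofReal_add (re_inner_self_nonneg hT _) (re_inner_self_nonneg hX _)]
  refine ENNReal.ofReal_le_ofReal ?_
  have := re_inner_self_nonneg (sub_nonneg.2 h) (basis H i)
  simp only [sub_apply, add_apply, inner_sub_right, inner_add_right, Complex.sub_re,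
    Complex.add_re] at this
  linarith

/-- The operator `T + X - S` is positive and trace class, so its trace against `A` is nonnegative.
Additivity in the first factor is read off the series in the fixed basis, since the series with
square roots is not termwise additive in `T`. -/
lemma re_trace_mul_le_add {S T X A : H →L[ℂ] H} (hS : 0 ≤ S) (hS1 : IsTraceClass S) (hT : 0 ≤ T)
    (hT1 : IsTraceClass T) (hX : 0 ≤ X) (hX1 : IsTraceClass X) (hA : 0 ≤ A) (h : S ≤ T + X) :
    (trace (S * A)).re ≤ (trace (T * A)).re + (trace (X * A)).re := by
  have hY : 0 ≤ T + X - S := sub_nonneg.2 h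
  have hY1 : IsTraceClass (T + X - S) :=
    isTraceClass_of_le_add hY hT hT1 hX hX1 (sub_le_self _ hS)
  have key : trace (T * A) + trace (X * A) - trace (S * A) = trace ((T + X - S) * A) := by
    refine (((hasSum_trace_mul hT hT1 A).1.add (hasSum_trace_mul hX hX1 A).1).sub
      (hasSum_trace_mul hS hS1 A).1).unique ?_
    simpa [sub_mul, add_mul, inner_sub_right, inner_add_right] using
      (hasSum_trace_mul hY hY1 A).1
  have h2 := re_trace_mul_nonneg hY hY1 hA
  rw [← key] at h2
  simp only [Complex.sub_re, Complex.add_re] at h2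
  linarith

lemma ofReal_re_trace_mul_le {T A : H →L[ℂ] H} (hT : 0 ≤ T) (hT1 : IsTraceClass T) (hA : 0 ≤ A)
    (hA1 : A ≤ 1) : ENNReal.ofReal (trace (T * A)).re ≤ traceNorm T := by
  rw [ofReal_trace_mul hT hT1 hA, traceNorm_of_nonneg hT]
  refine ENNReal.tsum_le_tsum fun i => ENNReal.ofReal_le_ofReal ?_
  rw [← inner_sqrt_sqrt hT]
  have := re_inner_self_nonneg (sub_nonneg.2 hA1) (CFC.sqrt T (basis H i))
  simp only [sub_apply, one_apply_eq_self, inner_sub_right, Complex.sub_re] at this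
  linarith

/-- Along weakly convergent bounded families, `Tr (T A)` converges. -/
lemma tendsto_re_trace_mul {ι : Type*} {F : Filter ι} {T : H →L[ℂ] H} (hT : 0 ≤ T)
    (hT1 : IsTraceClass T) {A : ι → H →L[ℂ] H} {B : H →L[ℂ] H} {C : ℝ} (hC : ∀ i, ‖A i‖ ≤ C)
    (hA : ∀ x, Tendsto (fun i => inner ℂ x (A i x)) F (𝓝 (inner ℂ x (B x)))) :
    Tendsto (fun i => (trace (T * A i)).re) F (𝓝 (trace (T * B)).re) := by
  simp_rw [← (hasSum_re_trace_mul hT hT1 _).tsum_eq]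
  refine tendsto_tsum_of_dominated_convergence ((summable_sqrt_sq hT hT1).mul_left C)
    (fun i => (Complex.continuous_re.tendsto _).comp (hA _)) (Eventually.of_forall fun i j => ?_)
  refine (Complex.abs_re_le_norm _).trans ((norm_inner_le_norm _ _).trans ?_)
  have := (A i).le_of_opNorm_le (hC i) (CFC.sqrt T (basis H j))
  nlinarith [norm_nonneg (CFC.sqrt T (basis H j))]

end Trace

end QuantumDecision

end

noncomputable section

namespace QuantumDecision

/-! ### Scalar measures and integrals attached to a POVM. -/

section Measurements

variable {U H : Type*} [MeasurableSpace U]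
  [NormedAddCommGroup H] [InnerProductSpace ℂ H] [CompleteSpace H]

/-- The measure `B ↦ ⟪x, M(B) x⟫` attached to a vector `x` and a measurement `M`. -/
def POVM.diag (M : POVM U H) (x : H) : Measure U :=
  Measure.ofMeasurable (fun B _ => ENNReal.ofReal (inner ℂ x (M.toFun B x)).re)
    (by simp [M.apply_empty])
    (by
      intro B hB hd
      have h := Complex.hasSum_re (M.hasSum_iUnion B hB hd x x)
      rw [← h.tsum_eq, ENNReal.ofReal_tsum_of_nonneg
        (fun j => re_inner_self_nonneg (M.nonneg _ (hB j)) x) h.summable])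

lemma POVM.diag_apply (M : POVM U H) (x : H) {B : Set U} (hB : MeasurableSet B) :
    M.diag x B = ENNReal.ofReal (inner ℂ x (M.toFun B x)).re :=
  Measure.ofMeasurable_apply B hB

lemma POVM.inner_eq_diag (M : POVM U H) (x : H) {B : Set U} (hB : MeasurableSet B) :
    inner ℂ x (M.toFun B x) = ((M.diag x).real B : ℂ) := by
  rw [Measure.real, M.diag_apply x hB,
    ENNReal.toReal_ofReal (re_inner_self_nonneg (M.nonneg _ hB) x),
    ← inner_self_eq_re (M.nonneg _ hB).isSelfAdjoint]

lemma POVM.diag_univ (M : POVM U H) (x : H) : M.diag x Set.univ = ENNReal.ofReal (‖x‖ ^ 2) := by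
  rw [M.diag_apply x MeasurableSet.univ, M.univ]
  congr 1
  exact inner_self_eq_norm_sq (𝕜 := ℂ) x

instance (M : POVM U H) (x : H) : IsFiniteMeasure (M.diag x) :=
  ⟨by rw [M.diag_univ]; exact ENNReal.ofReal_lt_top⟩

lemma POVM.diag_real_univ (M : POVM U H) (x : H) : (M.diag x).real Set.univ = ‖x‖ ^ 2 := by
  rw [Measure.real, M.diag_univ, ENNReal.toReal_ofReal (by positivity)]

lemma outcomeMeasure_apply {T : H →L[ℂ] H} (hT : 0 ≤ T) (hT1 : IsTraceClass T) (M : POVM U H)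
    {B : Set U} (hB : MeasurableSet B) :
    outcomeMeasure T hT hT1 M B = ENNReal.ofReal (trace (T * M.toFun B)).re :=
  Measure.ofMeasurable_apply B hB

/-- Reduces integrals against the outcome distribution to the quadratic forms of operators at the
vectors `T^{1/2} e_i`. -/
lemma outcomeMeasure_eq_sum {T : H →L[ℂ] H} (hT : 0 ≤ T) (hT1 : IsTraceClass T) (M : POVM U H) :
    outcomeMeasure T hT hT1 M = Measure.sum fun i => M.diag (CFC.sqrt T (basis H i)) := by
  ext B hB
  rw [outcomeMeasure_apply hT hT1 M hB, Measure.sum_apply _ hB,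
    ofReal_trace_mul hT hT1 (M.nonneg B hB)]
  simp_rw [M.diag_apply _ hB]

lemma POVM.le_one (M : POVM U H) {B : Set U} (hB : MeasurableSet B) : M.toFun B ≤ 1 := by
  rw [← sub_nonneg]
  refine nonneg_of_inner_eq_ofReal (q := fun x => ‖x‖ ^ 2 - (M.diag x).real B) (fun x => ?_)
    (fun x => ?_)
  · simp [M.inner_eq_diag x hB]
  · rw [sub_nonneg, ← M.diag_real_univ]
    exact measureReal_mono (Set.subset_univ _)

/-- Integrals of bounded measurable functions against a measurement exist as operators. -/
lemma POVM.exists_integral (M : POVM U H) {g : U → ℝ} (hg : StronglyMeasurable g) {C : ℝ}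
    (hC : 0 ≤ C) (hgC : ∀ u, ‖g u‖ ≤ C) :
    ∃ A : H →L[ℂ] H, ∀ x, inner ℂ x (A x) = ((∫ u, g u ∂M.diag x : ℝ) : ℂ) := by
  refine exists_inner_eq_of_tendsto (F := atTop) (C := C) hC
    (A := fun n => ∑ v ∈ (hg.approxBounded C n).range, v • M.toFun (hg.approxBounded C n ⁻¹' {v}))
    (r := fun n x => ∫ u, hg.approxBounded C n u ∂M.diag x) (fun n x => ?_) (fun n x => ?_)
    (fun x => ?_)
  · rw [SimpleFunc.integral_eq_sum _ (SimpleFunc.integrable_of_isFiniteMeasure _)]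
    simp [inner_smul_right_eq_smul,
      M.inner_eq_diag x (SimpleFunc.measurableSet_fiber _ _),
      mul_comm]
  · have := norm_integral_le_of_norm_le_const (μ := M.diag x)
      (Eventually.of_forall fun u => hg.norm_approxBounded_le hC n u)
    rwa [M.diag_real_univ] at this
  · refine tendsto_integral_of_dominated_convergence (fun _ => C)
      (fun n => (hg.approxBounded C n).aestronglyMeasurable) (integrable_const _)
      (fun n => Eventually.of_forall fun u => hg.norm_approxBounded_le hC n u)
      (Eventually.of_forall fun u => hg.tendsto_approxBounded_of_norm_le (hgC u))

end Measurements

/-! ### Positive unital maps on `C(U, ℝ)`: convexity and compactness. -/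

section ContinuousMeasurements

variable {U H : Type*} [TopologicalSpace U]
  [NormedAddCommGroup H] [InnerProductSpace ℂ H] [CompleteSpace H]

/-- Positive unital operator-valued linear maps on `C(U, ℝ)`. -/
structure IsPositiveUnital (Ψ : C(U, ℝ) →ₗ[ℝ] H →L[ℂ] H) : Prop where
  nonneg : ∀ g, 0 ≤ g → 0 ≤ Ψ g
  one : Ψ 1 = 1

namespace IsPositiveUnital

variable {Ψ : C(U, ℝ) →ₗ[ℝ] H →L[ℂ] H}

lemma mono (h : IsPositiveUnital Ψ) {g g' : C(U, ℝ)} (hg : g ≤ g') : Ψ g ≤ Ψ g' := by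
  rw [← sub_nonneg, ← map_sub]
  exact h.nonneg _ (sub_nonneg.2 hg)

lemma re_inner_mono (h : IsPositiveUnital Ψ) {g g' : C(U, ℝ)} (hg : g ≤ g') (x : H) :
    (inner ℂ x (Ψ g x)).re ≤ (inner ℂ x (Ψ g' x)).re := by
  have := re_inner_self_nonneg (sub_nonneg.2 (h.mono hg)) x
  simpa [inner_sub_right] using this

/-- Monotonicity applied to `-‖g‖ ≤ g ≤ ‖g‖`, constants being sent to multiples of the identity. -/
lemma abs_re_inner_le [CompactSpace U] (h : IsPositiveUnital Ψ) (g : C(U, ℝ)) (x : H) :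
    |(inner ℂ x (Ψ g x)).re| ≤ ‖g‖ * ‖x‖ ^ 2 := by
  have e : ∀ c : ℝ, (inner ℂ x (Ψ (c • 1) x)).re = c * ‖x‖ ^ 2 := fun c => by
    simp [h.one, inner_smul_right_eq_smul, ← Complex.ofReal_pow]
  rw [abs_le, ← neg_mul, ← e, ← e]
  refine ⟨h.re_inner_mono (fun u => ?_) x, h.re_inner_mono (fun u => ?_) x⟩
  · simpa using neg_le_of_abs_le (g.norm_coe_le_norm u)
  · simpa using le_of_abs_le (g.norm_coe_le_norm u)

lemma inner_eq_re (h : IsPositiveUnital Ψ) (g : C(U, ℝ)) (x : H) :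
    inner ℂ x (Ψ g x) = ((inner ℂ x (Ψ g x)).re : ℂ) := by
  refine inner_self_eq_re ?_ x
  rw [← posPart_sub_negPart g, map_sub]
  exact (h.nonneg _ (posPart_nonneg g)).isSelfAdjoint.sub
    (h.nonneg _ (negPart_nonneg g)).isSelfAdjoint

lemma norm_le [CompactSpace U] (h : IsPositiveUnital Ψ) (g : C(U, ℝ)) : ‖Ψ g‖ ≤ ‖g‖ :=
  norm_le_of_abs_inner_le (norm_nonneg g) (h.inner_eq_re g) (h.abs_re_inner_le g)

end IsPositiveUnital

/-- Positive unital maps form a convex set. -/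
lemma convex_isPositiveUnital :
    Convex ℝ {Ψ : C(U, ℝ) →ₗ[ℝ] H →L[ℂ] H | IsPositiveUnital Ψ} := by
  intro Ψ hΨ Φ hΦ a b ha hb hab
  refine ⟨fun g hg => ?_, ?_⟩
  · exact add_nonneg (smul_nonneg ha (hΨ.nonneg g hg)) (smul_nonneg hb (hΦ.nonneg g hg))
  · simp [hΨ.one, hΦ.one, ← add_smul, hab]

lemma isPositiveUnital_eval (u : U) :
    IsPositiveUnital ((ContinuousMap.evalCLM ℝ u : C(U, ℝ) →L[ℝ] ℝ).toLinearMap.smulRight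
      (1 : H →L[ℂ] H)) :=
  ⟨fun g hg => smul_nonneg (hg u) zero_le_one, by ext x; simp⟩

/-- Positive unital maps have limits in the point-weak operator topology along ultrafilters. -/
lemma exists_isPositiveUnital_tendsto [CompactSpace U] {ι : Type*} (F : Ultrafilter ι)
    {Ψ : ι → C(U, ℝ) →ₗ[ℝ] H →L[ℂ] H} (hΨ : ∀ i, IsPositiveUnital (Ψ i)) :
    ∃ Φ : C(U, ℝ) →ₗ[ℝ] H →L[ℂ] H, IsPositiveUnital Φ ∧
      ∀ g x, Tendsto (fun i => inner ℂ x (Ψ i g x)) F (𝓝 (inner ℂ x (Φ g x))) := by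
  choose Φ hΦ using fun g => exists_tendsto_inner F (fun i => Ψ i g) (fun i => (hΨ i).norm_le g)
  refine ⟨⟨⟨Φ, fun g g' => eq_of_inner_self_eq fun x => ?_⟩, fun c g =>
    eq_of_inner_self_eq fun x => ?_⟩, ⟨fun g hg => ?_, eq_of_inner_self_eq fun x => ?_⟩,
    fun g x => hΦ g x x⟩
  · refine tendsto_nhds_unique (hΦ (g + g') x x) ?_
    simpa [inner_add_right] using (hΦ g x x).add (hΦ g' x x)
  · refine tendsto_nhds_unique (hΦ (c • g) x x) ?_
    simpa [inner_smul_right_eq_smul] using (hΦ g x x).const_smul c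
  · refine nonneg_of_inner_eq_ofReal (q := fun x => (inner ℂ x (Φ g x)).re) (fun x => ?_)
      (fun x => ?_)
    · refine tendsto_nhds_unique (hΦ g x x) ?_
      exact (((Complex.continuous_ofReal.comp Complex.continuous_re).tendsto _).comp
        (hΦ g x x)).congr fun i => ((hΨ i).inner_eq_re g x).symm
    · exact ge_of_tendsto ((Complex.continuous_re.tendsto _).comp (hΦ g x x))
        (Eventually.of_forall fun i => re_inner_self_nonneg ((hΨ i).nonneg g hg) x)
  · refine tendsto_nhds_unique (hΦ 1 x x) ?_
    simp [(hΨ _).one]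

end ContinuousMeasurements

end QuantumDecision

end

noncomputable section

namespace QuantumDecision

/-! ### Operator-valued Riesz representation. -/

section Riesz

variable {U H : Type*} [MetricSpace U] [CompactSpace U] [MeasurableSpace U] [BorelSpace U]
  [NormedAddCommGroup H] [InnerProductSpace ℂ H] [CompleteSpace H]

/-- `Ψ` is integration against the measurement `M`. -/
def Represents (M : POVM U H) (Ψ : C(U, ℝ) →ₗ[ℝ] H →L[ℂ] H) : Prop :=
  ∀ g x, inner ℂ x (Ψ g x) = ((∫ u, g u ∂M.diag x : ℝ) : ℂ)

lemma Represents.isPositiveUnital {M : POVM U H} {Ψ : C(U, ℝ) →ₗ[ℝ] H →L[ℂ] H}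
    (h : Represents M Ψ) : IsPositiveUnital Ψ :=
  ⟨fun g hg => nonneg_of_inner_eq_ofReal (h g) fun _ => integral_nonneg hg,
    eq_of_inner_self_eq fun x => by rw [h]; simp [M.diag_real_univ]⟩

lemma continuous_integrable (μ : Measure U) [IsFiniteMeasure μ] (g : C(U, ℝ)) :
    Integrable g μ :=
  g.continuous.integrable_of_hasCompactSupport (HasCompactSupport.of_compactSpace g)

lemma POVM.exists_represents (M : POVM U H) :
    ∃ Ψ : C(U, ℝ) →ₗ[ℝ] H →L[ℂ] H, Represents M Ψ := by
  choose Ψ hΨ using fun g : C(U, ℝ) => M.exists_integral g.continuous.stronglyMeasurable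
    (norm_nonneg g) g.norm_coe_le_norm
  refine ⟨⟨⟨Ψ, fun g g' => eq_of_inner_self_eq fun x => ?_⟩, fun c g =>
    eq_of_inner_self_eq fun x => ?_⟩, hΨ⟩
  · rw [add_apply, inner_add_right, hΨ, hΨ, hΨ, ← Complex.ofReal_add,
      ← integral_add (continuous_integrable _ g) (continuous_integrable _ g')]
    rfl
  · simp [inner_smul_right_eq_smul, hΨ, integral_const_mul]

/-- For fixed `x` this is the scalar Riesz–Markov–Kakutani theorem; compactness of `U` makes every
continuous function compactly supported. -/
lemma IsPositiveUnital.exists_measure {Ψ : C(U, ℝ) →ₗ[ℝ] H →L[ℂ] H} (h : IsPositiveUnital Ψ)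
    (x : H) : ∃ μ : Measure U, IsFiniteMeasure μ ∧
      ∀ g : C(U, ℝ), ∫ u, g u ∂μ = (inner ℂ x (Ψ g x)).re := by
  let Λ₀ : CompactlySupportedContinuousMap U ℝ →ₗ[ℝ] ℝ :=
    { toFun := fun g => (inner ℂ x (Ψ g.toContinuousMap x)).re
      map_add' := fun g g' => by
        have : (g + g').toContinuousMap = g.toContinuousMap + g'.toContinuousMap := rfl
        rw [this, map_add, add_apply, inner_add_right, Complex.add_re]
      map_smul' := fun c g => by
        have : (c • g).toContinuousMap = c • g.toContinuousMap := rfl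
        simp [this, inner_smul_right_eq_smul] }
  let Λ := PositiveLinearMap.mk₀ Λ₀ fun g hg => re_inner_self_nonneg (h.nonneg _ hg) x
  refine ⟨RealRMK.rieszMeasure Λ, inferInstance, fun g => ?_⟩
  exact RealRMK.integral_rieszMeasure Λ (CompactlySupportedContinuousMap.continuousMapEquiv g)

lemma tendsto_integral_apprSeq {F : Set U} (hF : IsClosed F) (μ : Measure U) [IsFiniteMeasure μ] :
    Tendsto (fun n => ∫ u, (hF.apprSeq n u : ℝ) ∂μ) atTop (𝓝 (μ.real F)) := by
  rw [← integral_indicator_one hF.measurableSet]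
  refine tendsto_integral_of_dominated_convergence (fun _ => 1)
    (fun n => (NNReal.continuous_coe.comp (hF.apprSeq n).continuous).aestronglyMeasurable)
    (integrable_const _) (fun n => Eventually.of_forall fun u => ?_)
    (Eventually.of_forall fun u => ?_)
  · simpa using HasOuterApproxClosed.apprSeq_apply_le_one hF n u
  · have h := (NNReal.continuous_coe.tendsto _).comp
      (tendsto_pi_nhds.1 (HasOuterApproxClosed.tendsto_apprSeq hF) u)
    have e : F.indicator (1 : U → ℝ) u = (F.indicator (fun _ => (1 : ℝ≥0)) u : ℝ≥0) := by
      by_cases hu : u ∈ F <;> simp [hu]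
    rwa [e]

lemma hasSum_measureReal_iUnion (μ : Measure U) [IsFiniteMeasure μ] {B : ℕ → Set U}
    (hd : Pairwise (Function.onFun Disjoint B)) (hB : ∀ j, MeasurableSet (B j)) :
    HasSum (fun j => μ.real (B j)) (μ.real (⋃ j, B j)) := by
  have h := measure_iUnion (μ := μ) hd hB
  have h2 := ENNReal.hasSum_toReal (h ▸ measure_ne_top μ _)
  rwa [← ENNReal.tsum_toReal_eq fun j => measure_ne_top μ _, ← h] at h2

/-- If the integrals of continuous functions against a family of measures indexed by vectors are
quadratic forms of bounded operators, then so are the measures of Borel sets. -/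
lemma exists_operator_of_measure {Ψ : C(U, ℝ) →ₗ[ℝ] H →L[ℂ] H} {μ : H → Measure U}
    [∀ x, IsFiniteMeasure (μ x)]
    (hμ : ∀ g x, inner ℂ x (Ψ g x) = ((∫ u, g u ∂μ x : ℝ) : ℂ))
    (hμ1 : ∀ x, (μ x).real Set.univ = ‖x‖ ^ 2) {B : Set U} (hB : MeasurableSet B) :
    ∃ A : H →L[ℂ] H, ∀ x, inner ℂ x (A x) = ((μ x).real B : ℂ) := by
  have hle : ∀ (B : Set U) x, |(μ x).real B| ≤ 1 * ‖x‖ ^ 2 := fun B x => by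
    rw [one_mul, abs_of_nonneg measureReal_nonneg, ← hμ1]
    exact measureReal_mono (Set.subset_univ _)
  have hgen : ‹MeasurableSpace U› = MeasurableSpace.generateFrom {F | IsClosed F} :=
    BorelSpace.measurable_eq.trans borel_eq_generateFrom_isClosed
  -- Dynkin's π-λ argument from closed sets. Every limit below is of forms bounded by `‖x‖²`, so it
  -- stays the form of a bounded operator.
  induction B, hB using MeasurableSpace.induction_on_inter hgen isPiSystem_isClosed with
  | empty => exact ⟨0, by simp⟩
  | basic F hF =>
    replace hF : IsClosed F := hF
    let g : ℕ → C(U, ℝ) := fun n =>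
      ⟨fun u => hF.apprSeq n u, NNReal.continuous_coe.comp (hF.apprSeq n).continuous⟩
    refine exists_inner_eq_of_tendsto zero_le_one (fun n x => hμ (g n) x) (fun n x => ?_)
      (fun x => tendsto_integral_apprSeq hF (μ x))
    have := norm_integral_le_of_norm_le_const (μ := μ x) (f := g n) (C := 1)
      (Eventually.of_forall fun u => by
        simpa [g] using HasOuterApproxClosed.apprSeq_apply_le_one hF n u)
    rwa [hμ1] at this
  | compl B hB ih =>
    obtain ⟨A, hA⟩ := ih
    refine ⟨1 - A, fun x => ?_⟩
    rw [measureReal_compl hB, hμ1]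
    simp [hA]
  | iUnion B hd hB ih =>
    choose A hA using ih
    have hs := fun x => hasSum_measureReal_iUnion (μ x) hd hB
    refine exists_inner_eq_of_tendsto (F := atTop) zero_le_one
      (A := fun n => ∑ j ∈ Finset.range n, A j)
      (r := fun n x => ∑ j ∈ Finset.range n, (μ x).real (B j)) (fun n x => ?_) (fun n x => ?_)
      (fun x => (hs x).tendsto_sum_nat)
    · simp [hA]
    · refine le_trans ?_ (hle (⋃ j, B j) x)
      rw [abs_of_nonneg (Finset.sum_nonneg fun _ _ => measureReal_nonneg),
        abs_of_nonneg measureReal_nonneg]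
      exact sum_le_hasSum _ (fun _ _ => measureReal_nonneg) (hs x)

/-- Every positive unital map on `C(U, ℝ)` is integration against a measurement. -/
lemma IsPositiveUnital.exists_povm {Ψ : C(U, ℝ) →ₗ[ℝ] H →L[ℂ] H} (h : IsPositiveUnital Ψ) :
    ∃ M : POVM U H, Represents M Ψ := by
  choose μ hfin hμ using h.exists_measure
  have hμ' : ∀ g x, inner ℂ x (Ψ g x) = ((∫ u, g u ∂μ x : ℝ) : ℂ) := fun g x => by
    rw [hμ, ← h.inner_eq_re]
  have hμ1 : ∀ x, (μ x).real Set.univ = ‖x‖ ^ 2 := fun x => by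
    have := hμ x 1
    simpa [h.one, ← Complex.ofReal_pow] using this
  choose A hA using fun (B : Set U) (hB : MeasurableSet B) =>
    exists_operator_of_measure hμ' hμ1 hB
  classical
  let M₀ : Set U → H →L[ℂ] H := fun B => if hB : MeasurableSet B then A B hB else 0
  have hM₀ : ∀ B, MeasurableSet B → ∀ x, inner ℂ x (M₀ B x) = ((μ x).real B : ℂ) :=
    fun B hB x => by simp only [M₀, dif_pos hB, hA]
  let M : POVM U H :=
    { toFun := M₀
      nonneg := fun B hB => nonneg_of_inner_eq_ofReal (hM₀ B hB) fun _ => measureReal_nonneg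
      hasSum_iUnion := fun B hB hd x y => by
        have hs : ∀ x, HasSum (fun j => inner ℂ x (M₀ (B j) x))
            (inner ℂ x (M₀ (⋃ j, B j) x)) := fun x => by
          simp_rw [hM₀ _ (hB _), hM₀ _ (MeasurableSet.iUnion hB), Complex.hasSum_ofReal]
          exact hasSum_measureReal_iUnion (μ x) hd hB
        -- Countable additivity is known on the diagonal, and polarization carries it to all pairs
        -- `x, y`.
        simp_rw [inner_polarization _ x y]
        exact ((((hs _).sub (hs _)).sub ((hs _).mul_left _)).add ((hs _).mul_left _)).div_const _
      univ := eq_of_inner_self_eq fun x => by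
        rw [hM₀ _ MeasurableSet.univ, hμ1]
        simp }
  refine ⟨M, fun g x => ?_⟩
  have : M.diag x = μ x := by
    ext B hB
    rw [M.diag_apply x hB, hM₀ B hB, Complex.ofReal_re, ofReal_measureReal]
  rw [this, hμ']

/-- Both sides equal the sum over `i` of the quadratic form of `Ψ g` at `T^{1/2} e_i`. -/
lemma integral_outcomeMeasure {T : H →L[ℂ] H} (hT : 0 ≤ T) (hT1 : IsTraceClass T) {M : POVM U H}
    {Ψ : C(U, ℝ) →ₗ[ℝ] H →L[ℂ] H} (h : Represents M Ψ) (g : C(U, ℝ)) :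
    ∫ u, g u ∂outcomeMeasure T hT hT1 M = (trace (T * Ψ g)).re := by
  have hfin : IsFiniteMeasure (outcomeMeasure T hT hT1 M) :=
    ⟨by rw [outcomeMeasure_apply hT hT1 M MeasurableSet.univ]; exact ENNReal.ofReal_lt_top⟩
  have hint := continuous_integrable (outcomeMeasure T hT hT1 M) g
  rw [outcomeMeasure_eq_sum] at hint ⊢
  refine (hasSum_integral_measure hint).unique ?_
  have := hasSum_re_trace_mul hT hT1 (Ψ g)
  simp_rw [h g, Complex.ofReal_re] at this
  exact this

end Riesz

end QuantumDecision

end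

noncomputable section

namespace QuantumDecision

/-! ### The risk as a trace; its boundedness and measurability. -/

section Risk

variable {H : Type*} [NormedAddCommGroup H] [InnerProductSpace ℂ H] [CompleteSpace H]
  {Θ : Type*} [MetricSpace Θ] [CompactSpace Θ] [MeasurableSpace Θ] [BorelSpace Θ]
  {U : Type*} [MetricSpace U] [CompactSpace U] [MeasurableSpace U] [BorelSpace U]

/-- The section `u ↦ w (θ, u)` of a continuous loss function. -/
def lossAt {w : Θ × U → ℝ} (hw : Continuous w) (θ : Θ) : C(U, ℝ) :=
  ⟨fun u => w (θ, u), hw.comp (Continuous.prodMk_right θ)⟩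

lemma risk_eq_trace (ρ : Model Θ H) {w : Θ × U → ℝ} (hw : Continuous w) {M : POVM U H}
    {Ψ : C(U, ℝ) →ₗ[ℝ] H →L[ℂ] H} (h : Represents M Ψ) (θ : Θ) :
    risk ρ w M θ = (trace (ρ.toFun θ * Ψ (lossAt hw θ))).re :=
  integral_outcomeMeasure (ρ.nonneg θ) (ρ.traceClass θ) h (lossAt hw θ)

instance (ρ : Model Θ H) (M : POVM U H) (θ : Θ) :
    IsProbabilityMeasure (outcomeMeasure (ρ.toFun θ) (ρ.nonneg θ) (ρ.traceClass θ) M) :=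
  ⟨by rw [outcomeMeasure_apply _ _ M MeasurableSet.univ, M.univ, mul_one, ρ.trace_eq_one]; simp⟩

lemma abs_risk_le (ρ : Model Θ H) {w : Θ × U → ℝ} {C : ℝ} (hC : ∀ p, ‖w p‖ ≤ C) (M : POVM U H)
    (θ : Θ) : ‖risk ρ w M θ‖ ≤ C := by
  simpa [risk] using norm_integral_le_of_norm_le_const
    (μ := outcomeMeasure (ρ.toFun θ) (ρ.nonneg θ) (ρ.traceClass θ) M)
    (Eventually.of_forall fun u => hC (θ, u))

/-- Outcome probabilities of a regular model depend continuously on the parameter. -/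
lemma continuous_re_trace_mul {ρ : Model Θ H} (hρ : IsRegular ρ.toFun) {A : H →L[ℂ] H}
    (hA : 0 ≤ A) (hA1 : A ≤ 1) : Continuous fun θ => (trace (ρ.toFun θ * A)).re := by
  rw [Metric.continuous_iff]
  intro θ ε hε
  have h1 : ∀ᶠ δ in 𝓝[>] (0 : ℝ), modulus ρ.toFun Set.univ δ < ENNReal.ofReal ε :=
    (hρ Set.univ isCompact_univ).eventually (gt_mem_nhds (ENNReal.ofReal_pos.2 hε))
  obtain ⟨δ, hδ, hδ0⟩ := (h1.and self_mem_nhdsWithin).exists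
  refine ⟨δ, hδ0, fun η hη => ?_⟩
  simp only [modulus, iInf_lt_iff, Set.mem_ofPred_eq] at hδ
  obtain ⟨X, ⟨hX1, hX⟩, hXε⟩ := hδ
  -- Comparing `θ` with itself gives `0 ≤ X`.
  have hX0 : 0 ≤ X := by
    have := hX θ trivial θ trivial (by simpa using hδ0)
    simpa using this.2
  have h2 := hX η trivial θ trivial hη
  have h3 : (trace (X * A)).re < ε := by
    have := (ofReal_re_trace_mul_le hX0 hX1 hA hA1).trans_lt hXε
    exact (ENNReal.ofReal_lt_ofReal_iff hε).1 this
  have h4 := re_trace_mul_le_add (ρ.nonneg η) (ρ.traceClass η) (ρ.nonneg θ) (ρ.traceClass θ)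
    hX0 hX1 hA (by rw [← sub_le_iff_le_add']; exact h2.2)
  have h5 := re_trace_mul_le_add (ρ.nonneg θ) (ρ.traceClass θ) (ρ.nonneg η) (ρ.traceClass η)
    hX0 hX1 hA (by
      rw [← sub_le_iff_le_add', ← neg_sub]
      exact neg_le.1 h2.1)
  rw [Real.dist_eq, abs_lt]
  constructor <;> linarith

/-- Outcome probabilities are continuous in `θ`, so the outcome distributions form a Markov kernel,
and integrating the jointly measurable `w` against a kernel preserves measurability. -/
lemma stronglyMeasurable_risk {ρ : Model Θ H} (hρ : IsRegular ρ.toFun) {w : Θ × U → ℝ}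
    (hw : Continuous w) (M : POVM U H) : StronglyMeasurable (risk ρ w M) := by
  let κ : ProbabilityTheory.Kernel Θ U :=
    { toFun := fun θ => outcomeMeasure (ρ.toFun θ) (ρ.nonneg θ) (ρ.traceClass θ) M
      measurable' := Measure.measurable_of_measurable_coe _ fun B hB => by
        simp_rw [outcomeMeasure_apply _ _ M hB]
        exact ENNReal.measurable_ofReal.comp
          (continuous_re_trace_mul hρ (M.nonneg B hB) (M.le_one hB)).measurable }
  have : ProbabilityTheory.IsMarkovKernel κ :=
    ⟨fun θ => inferInstanceAs (IsProbabilityMeasure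
      (outcomeMeasure (ρ.toFun θ) (ρ.nonneg θ) (ρ.traceClass θ) M))⟩
  exact hw.stronglyMeasurable.integral_kernel_prod_right' (κ := κ)

lemma integrable_risk {ρ : Model Θ H} (hρ : IsRegular ρ.toFun) {w : Θ × U → ℝ}
    (hw : Continuous w) {C : ℝ} (hC : ∀ p, ‖w p‖ ≤ C) (M : POVM U H) (π : Measure Θ)
    [IsFiniteMeasure π] : Integrable (risk ρ w M) π :=
  Integrable.of_bound (stronglyMeasurable_risk hρ hw M).aestronglyMeasurable C
    (Eventually.of_forall (abs_risk_le ρ hC M))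

end Risk

/-! ### Finite-dimensional separation. -/

section Minimax

/-- A convex set of functions on a finite type whose averages against all probability vectors can
be made at most `0` up to any error has elements that are pointwise small. -/
lemma exists_forall_lt_of_convex {ι : Type*} [Fintype ι] {S : Set (ι → ℝ)} (hS : Convex ℝ S)
    (hne : S.Nonempty)
    (h : ∀ p : ι → ℝ, (∀ i, 0 ≤ p i) → ∑ i, p i = 1 → ∀ ε > 0, ∃ v ∈ S, ∑ i, p i * v i < ε)
    {ε : ℝ} (hε : 0 < ε) : ∃ v ∈ S, ∀ i, v i < ε := by
  classical
  by_contra! hcon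
  obtain ⟨φ, u, hu1, hu2⟩ := geometric_hahn_banach_open
    (s := Set.pi Set.univ fun _ : ι => Set.Iio ε)
    (convex_pi fun _ _ => convex_Iio ε) (isOpen_set_pi Set.finite_univ fun _ _ => isOpen_Iio) hS
    (Set.disjoint_left.2 fun v hv hvS => by
      obtain ⟨i, hi⟩ := hcon v hvS
      exact absurd (hv i trivial) (not_lt.2 hi))
  set c : ι → ℝ := fun i => φ (Pi.single i 1) with hc
  have hφ : ∀ v, φ v = ∑ i, c i * v i := fun v => by
    conv_lhs => rw [← Finset.univ_sum_single v]
    rw [map_sum]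
    refine Finset.sum_congr rfl fun i _ => ?_
    have : Pi.single i (v i) = v i • (Pi.single i 1 : ι → ℝ) := by
      rw [← Pi.single_smul]; simp
    rw [this, map_smul, smul_eq_mul, mul_comm]
  -- The origin lies in the box `{v | ∀ i, v i < ε}`.
  have hu0 : 0 < u := by
    simpa using hu1 0 (fun i _ => hε)
  -- If `c i < 0`, the point with `i`-th entry `u / c i < 0` and zeros elsewhere is in the box, yet
  -- `φ` equals `u` there.
  have hc0 : ∀ i, 0 ≤ c i := fun i => by
    by_contra! hi
    have := hu1 ((u / c i) • Pi.single i 1) (fun j _ => by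
      have h1 : u / c i < 0 := div_neg_of_pos_of_neg hu0 hi
      rcases eq_or_ne j i with rfl | hj
      · simpa using h1.trans hε
      · simpa [hj] using hε)
    rw [map_smul, smul_eq_mul, div_mul_cancel₀ _ hi.ne] at this
    exact lt_irrefl _ this
  have hs : 0 < ∑ i, c i := by
    refine lt_of_le_of_ne (Finset.sum_nonneg fun i _ => hc0 i) fun h0 => ?_
    obtain ⟨v, hv⟩ := hne
    have h1 := hu2 v hv
    rw [hφ, Finset.sum_eq_zero fun i _ => ?_] at h1
    · linarith
    · rw [(Finset.sum_eq_zero_iff_of_nonneg fun i _ => hc0 i).1 h0.symm i (Finset.mem_univ i),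
        zero_mul]
  -- With the normalized `c` as weights and tolerance `u / ∑ c`, the hypothesis yields `v ∈ S` with
  -- `φ v < u`, against the separation.
  obtain ⟨v, hv, hv2⟩ := h (fun i => c i / ∑ j, c j) (fun i => div_nonneg (hc0 i) hs.le)
    (by rw [← Finset.sum_div, div_self hs.ne']) (u / ∑ j, c j) (div_pos hu0 hs)
  simp_rw [div_mul_eq_mul_div] at hv2
  rw [← Finset.sum_div, div_lt_div_iff_of_pos_right hs, ← hφ] at hv2
  exact absurd (hu2 v hv) (not_le.2 hv2)

end Minimax

/-! ### From the Bayes condition to a measurement. -/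

section Theorem

variable {H : Type*} [NormedAddCommGroup H] [InnerProductSpace ℂ H] [CompleteSpace H]
  {Θ : Type*} [MetricSpace Θ] [CompactSpace Θ] [MeasurableSpace Θ] [BorelSpace Θ]
  {U : Type*} [MetricSpace U] [CompactSpace U] [Nonempty U] [MeasurableSpace U] [BorelSpace U]

lemma nonempty_isPositiveUnital :
    {Ψ : C(U, ℝ) →ₗ[ℝ] H →L[ℂ] H | IsPositiveUnital Ψ}.Nonempty :=
  ⟨_, isPositiveUnital_eval (Classical.arbitrary U)⟩

instance : Nonempty (POVM U H) :=
  let ⟨_, hΨ⟩ := nonempty_isPositiveUnital (U := U) (H := H)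
  ⟨hΨ.exists_povm.choose⟩

/-- The Bayes condition for finitely supported priors gives measurements that are almost good
enough on a given finite set of parameters. -/
lemma exists_isPositiveUnital_forall_mem_lt (ρ : Model Θ H) {w : Θ × U → ℝ} (hw : Continuous w)
    (f : Θ → ℝ)
    (h : ∀ π : Measure Θ, IsProbabilityMeasure π →
      ⨅ M : POVM U H, ∫ θ, risk ρ w M θ ∂π ≤ ∫ θ, f θ ∂π)
    (F : Finset Θ) {ε : ℝ} (hε : 0 < ε) :
    ∃ Ψ : C(U, ℝ) →ₗ[ℝ] H →L[ℂ] H, IsPositiveUnital Ψ ∧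
      ∀ θ ∈ F, (trace (ρ.toFun θ * Ψ (lossAt hw θ))).re < f θ + ε := by
  let v : (C(U, ℝ) →ₗ[ℝ] H →L[ℂ] H) → F → ℝ := fun Ψ θ =>
    (trace (ρ.toFun θ * Ψ (lossAt hw θ))).re - f θ
  have hS : Convex ℝ (v '' {Ψ | IsPositiveUnital Ψ}) := by
    rintro _ ⟨Ψ, hΨ, rfl⟩ _ ⟨Φ, hΦ, rfl⟩ a b ha hb hab
    refine ⟨a • Ψ + b • Φ, convex_isPositiveUnital hΨ hΦ ha hb hab, ?_⟩
    ext θ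
    simp only [v, LinearMap.add_apply, LinearMap.smul_apply, Pi.add_apply, Pi.smul_apply,
      re_trace_mul_add (ρ.nonneg _) (ρ.traceClass _),
      re_trace_mul_smul (ρ.nonneg _) (ρ.traceClass _), smul_eq_mul]
    -- Subtracting `f` keeps the map affine because `a + b = 1`.
    linear_combination f θ * hab
  have hbayes : ∀ p : F → ℝ, (∀ i, 0 ≤ p i) → ∑ i, p i = 1 → ∀ δ > 0,
      ∃ y ∈ v '' {Ψ | IsPositiveUnital Ψ}, ∑ i, p i * y i < δ := by
    intro p hp0 hp1 δ hδ
    let π : Measure Θ := ∑ θ : F, ENNReal.ofReal (p θ) • Measure.dirac (θ : Θ)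
    have hπ : IsProbabilityMeasure π := ⟨by
      simp only [π, Measure.coe_finsetSum, Finset.sum_apply, Measure.smul_apply, measure_univ,
        smul_eq_mul, mul_one]
      rw [← ENNReal.ofReal_sum_of_nonneg fun i _ => hp0 i, hp1, ENNReal.ofReal_one]⟩
    have hint : ∀ g : Θ → ℝ, ∫ θ, g θ ∂π = ∑ θ : F, p θ * g θ := fun g => by
      rw [integral_finsetSum_measure fun θ _ =>
        (integrable_dirac (by simp)).smul_measure ENNReal.ofReal_ne_top]
      refine Finset.sum_congr rfl fun θ _ => ?_
      rw [integral_smul_measure, integral_dirac, ENNReal.toReal_ofReal (hp0 θ), smul_eq_mul]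
    obtain ⟨M, hM⟩ := exists_lt_of_ciInf_lt
      ((h π hπ).trans_lt (lt_add_of_pos_right _ hδ))
    obtain ⟨Ψ, hΨ⟩ := M.exists_represents
    refine ⟨_, ⟨Ψ, hΨ.isPositiveUnital, rfl⟩, ?_⟩
    rw [hint, hint] at hM
    simp only [v, ← risk_eq_trace ρ hw hΨ, mul_sub, Finset.sum_sub_distrib]
    linarith
  obtain ⟨_, ⟨Ψ, hΨ, rfl⟩, hlt⟩ :=
    exists_forall_lt_of_convex hS (nonempty_isPositiveUnital.image v) hbayes hε
  exact ⟨Ψ, hΨ, fun θ hθ => by have := hlt ⟨θ, hθ⟩; simp only [v] at this; linarith⟩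

lemma exists_povm_risk_le (ρ : Model Θ H) {w : Θ × U → ℝ} (hw : Continuous w) (f : Θ → ℝ)
    (h : ∀ π : Measure Θ, IsProbabilityMeasure π →
      ⨅ M : POVM U H, ∫ θ, risk ρ w M θ ∂π ≤ ∫ θ, f θ ∂π) :
    ∃ M : POVM U H, ∀ θ, risk ρ w M θ ≤ f θ := by
  classical
  choose Ψ hΨ hlt using fun p : Finset Θ × ℕ =>
    exists_isPositiveUnital_forall_mem_lt ρ hw f h p.1 (Nat.one_div_pos_of_nat (α := ℝ) (n := p.2))
  -- An ultrafilter finer than `atTop` eventually sees every `θ` in the finite set, while the error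
  -- `1 / (n + 1)` tends to `0`.
  obtain ⟨Φ, hΦ, hlim⟩ := exists_isPositiveUnital_tendsto
    (Ultrafilter.of (atTop : Filter (Finset Θ × ℕ))) hΨ
  obtain ⟨M, hM⟩ := hΦ.exists_povm
  refine ⟨M, fun θ => ?_⟩
  rw [risk_eq_trace ρ hw hM]
  have h1 := tendsto_re_trace_mul (ρ.nonneg θ) (ρ.traceClass θ)
    (fun p => (hΨ p).norm_le (lossAt hw θ)) (hlim (lossAt hw θ))
  have h2 : Tendsto (fun p : Finset Θ × ℕ => f θ + 1 / ((p.2 : ℝ) + 1)) atTop (𝓝 (f θ + 0)) :=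
    tendsto_const_nhds.add (tendsto_one_div_add_atTop_nhds_zero_nat.comp
      (by rw [← prod_atTop_atTop_eq]; exact tendsto_snd))
  rw [add_zero] at h2
  refine le_of_tendsto_of_tendsto h1 (h2.mono_left (Ultrafilter.of_le _)) ?_
  refine Ultrafilter.of_le _ ?_
  filter_upwards [eventually_ge_atTop (({θ}, 0) : Finset Θ × ℕ)] with p hp
  exact (hlt p θ (hp.1 (Finset.mem_singleton_self θ))).le

end Theorem

end QuantumDecision

end

theorem theorem1
    {H : Type*} [NormedAddCommGroup H] [InnerProductSpace ℂ H] [CompleteSpace H]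
    {Θ : Type*} [MetricSpace Θ] [CompactSpace Θ] [MeasurableSpace Θ] [BorelSpace Θ]
    {U : Type*} [MetricSpace U] [CompactSpace U] [Nonempty U] [MeasurableSpace U] [BorelSpace U]
    (ρ : QuantumDecision.Model Θ H) (hρ : QuantumDecision.IsRegular ρ.toFun)
    (w : Θ × U → ℝ) (hw : Continuous w)
    (f : Θ → ℝ) (hf : Continuous f) :
    (∃ M : QuantumDecision.POVM U H, ∀ θ, QuantumDecision.risk ρ w M θ ≤ f θ) ↔
      ∀ π : MeasureTheory.Measure Θ, MeasureTheory.IsProbabilityMeasure π →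
        ⨅ M : QuantumDecision.POVM U H, ∫ θ, QuantumDecision.risk ρ w M θ ∂π ≤ ∫ θ, f θ ∂π := by
  refine ⟨fun ⟨M, hM⟩ π hπ => ?_, QuantumDecision.exists_povm_risk_le ρ hw f⟩
  obtain ⟨C, hC⟩ := (isCompact_univ.image hw).isBounded.exists_norm_le
  have hC' : ∀ p, ‖w p‖ ≤ C := fun p => hC _ ⟨p, trivial, rfl⟩
  -- A real infimum lies below its members only for families bounded below; `-C` works since `|R_N|
  -- ≤ C` for every `N`.
  refine (ciInf_le ⟨-C, ?_⟩ M).trans (integral_mono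
    (QuantumDecision.integrable_risk hρ hw hC' M π)
    (hf.integrable_of_hasCompactSupport (HasCompactSupport.of_compactSpace f)) hM)
  rintro _ ⟨N, rfl⟩
  have := norm_integral_le_of_norm_le_const (μ := π)
    (Eventually.of_forall (QuantumDecision.abs_risk_le ρ hC' N))
  rw [probReal_univ, mul_one] at this
  exact neg_le_of_abs_le this
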